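/- Let $\mathcal H$ be a complex Hilbert space with inner product antilinear in its first entry. A linear relation in $\mathcal H$ is a linear subset $T$ of $\mathcal H\oplus\mathcal H$. Put $\operatorname{dom}T=\{f:(f,g)\in T\text{ for some }g\}$, $\operatorname{mul}T=\{g:(0,g)\in T\}$, $T^{-1}=\{(g,f):(f,g)\in T\}$, $-T=\{(f,-g):(f,g)\in T\}$, $T-\zeta I=\{(f,g-\zeta f):(f,g)\in T\}$ for $\zeta\in\mathbb C$, and $T^*=\{(h,k):\langle k,f\rangle=\langle h,g\rangle\text{ for all }(f,g)\in T\}$; $T$ is selfadjoint if $T=T^*$. The relation $T$ is bounded if there is $C>0$ with $\|g\|\le C\|f\|$ for all $(f,g)\in T$, in which case it is an operator, and $\mathcal B(\mathcal H)$ is the class of all bounded operators in $\mathcal H$ with domain $\mathcal H$. The spectrum of $T$ is $\sigma(T)=\mathbb C\setminus\{\zeta\in\mathbb C:(T-\zeta I)^{-1}\in\mathcal B(\mathcal H)\}$. The relation $T$ is lower semi-bounded if there is $m\in\mathbb R$ such that, for all $(f,g)\in T$, $\langle f,g\rangle$ is real and $\langle f,g\rangle\ge m\|f\|^2$; it is upper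 semi-bounded if $-T$ is lower semi-bounded. Let $A$ be a selfadjoint relation in $\mathcal H$, and let $A_A=A\cap\big((\operatorname{mul}A)^\perp\oplus(\operatorname{mul}A)^\perp\big)$, regarded as a relation in the Hilbert space $(\operatorname{mul}A)^\perp$. The following are equivalent: (i) $A$ is both lower and upper semi-bounded; (ii) $\sigma(A)$ is a bounded subset of $\mathbb R$; (iii) $A_A$ is a selfadjoint operator in $\mathcal B((\operatorname{mul}A)^\perp)$. In such a case, the numbers $$m_A=\inf\{\langle f,g\rangle:(f,g)\in A,\ \|f\|=1\},\qquad M_A=\sup\{\langle f,g\rangle:(f,g)\in A,\ \|f\|=1\},$$ are finite (with the convention $m_A=M_A=0$ if $\operatorname{dom}A=\{0\}$, when the set is empty), and they satisfy $$\sigma(A)\subset[m_A,M_A]\qquad\text{and}\qquad\|A_A\|=\max\{|m_A|,|M_A|\}.$$ -/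

import Mathlib

/-! Linear relations in a complex Hilbert space `H` are the linear subsets (not necessarily closed)
of `H ⊕ H`, here `Submodule ℂ (H × H)`; a pair `(f, g)` in the relation reads "`g` is an image
of `f`". The adjoint relation is Mathlib's `Submodule.adjoint`. -/

namespace LinearRelation

variable {H : Type*} [NormedAddCommGroup H] [InnerProductSpace ℂ H]

/-- The domain `{f : (f, g) ∈ T for some g}`. -/
def dom (T : Submodule ℂ (H × H)) : Submodule ℂ H :=
  T.map (LinearMap.fst ℂ H H)

/-- The multivalued part of the range, `{g : (0, g) ∈ T}`. -/
def mul (T : Submodule ℂ (H × H)) : Submodule ℂ H :=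
  T.comap (LinearMap.inr ℂ H H)

/-- The inverse relation `{(g, f) : (f, g) ∈ T}`. -/
def inverse (T : Submodule ℂ (H × H)) : Submodule ℂ (H × H) :=
  T.map (LinearMap.prod (LinearMap.snd ℂ H H) (LinearMap.fst ℂ H H))

/-- The relation `-T = {(f, -g) : (f, g) ∈ T}`. -/
def opposite (T : Submodule ℂ (H × H)) : Submodule ℂ (H × H) :=
  T.map (LinearMap.prod (LinearMap.fst ℂ H H) (-LinearMap.snd ℂ H H))

/-- The relation `T - ζ I = {(f, g - ζ f) : (f, g) ∈ T}`. -/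
def subScalar (T : Submodule ℂ (H × H)) (ζ : ℂ) : Submodule ℂ (H × H) :=
  T.map (LinearMap.prod (LinearMap.fst ℂ H H) (LinearMap.snd ℂ H H - ζ • LinearMap.fst ℂ H H))

/-- A relation is bounded if `‖g‖ ≤ C ‖f‖` on it for some `C > 0`; it is then single-valued. -/
def IsBounded (T : Submodule ℂ (H × H)) : Prop :=
  ∃ C : ℝ, 0 < C ∧ ∀ f g : H, (f, g) ∈ T → ‖g‖ ≤ C * ‖f‖

/-- `T ∈ 𝓑(H)`: the relation is a bounded operator whose domain is the whole space. -/
def IsBoundedOperator (T : Submodule ℂ (H × H)) : Prop :=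
  IsBounded T ∧ dom T = ⊤

/-- The regular set `ρ(T) = {ζ : (T - ζ I)⁻¹ ∈ 𝓑(H)}`. -/
def regularSet (T : Submodule ℂ (H × H)) : Set ℂ :=
  {ζ | IsBoundedOperator (inverse (subScalar T ζ))}

/-- The spectrum `σ(T) = ℂ \ ρ(T)`. -/
def spectrum (T : Submodule ℂ (H × H)) : Set ℂ :=
  (regularSet T)ᶜ

/-- A relation is selfadjoint if it equals its adjoint
`{(h, k) : ⟪k, f⟫ = ⟪h, g⟫ for all (f, g) ∈ T}`. -/
def IsSelfadjoint (T : Submodule ℂ (H × H)) : Prop :=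
  T = T.adjoint

/-- The restriction `T_S = T ∩ ((mul S)ᗮ ⊕ (mul S)ᗮ)`, a relation in the space `(mul S)ᗮ`. -/
noncomputable def restrict (T S : Submodule ℂ (H × H)) : Submodule ℂ ((mul S)ᗮ × (mul S)ᗮ) :=
  T.comap (LinearMap.prodMap (mul S)ᗮ.subtype (mul S)ᗮ.subtype)

/-- Lower semi-boundedness: for some real `m`, each `⟪f, g⟫` with `(f, g) ∈ T` is real and at least
`m ‖f‖ ^ 2`. -/
def IsLowerSemibounded (T : Submodule ℂ (H × H)) : Prop :=
  ∃ m : ℝ, ∀ f g : H, (f, g) ∈ T →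
    (inner ℂ f g).im = 0 ∧ m * ‖f‖ ^ 2 ≤ (inner ℂ f g).re

/-- `T` is upper semi-bounded if `-T` is lower semi-bounded. -/
def IsUpperSemibounded (T : Submodule ℂ (H × H)) : Prop :=
  IsLowerSemibounded (opposite T)

/-- The set `{⟪f, g⟫ : (f, g) ∈ T, ‖f‖ = 1}` of real numbers. (For a symmetric relation every
`⟪f, g⟫` is real.) -/
def formValues (T : Submodule ℂ (H × H)) : Set ℝ :=
  {r | ∃ f g : H, (f, g) ∈ T ∧ ‖f‖ = 1 ∧ inner ℂ f g = (r : ℂ)}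

/-- The greatest lower bound `m_T`; it is `0` by convention if `dom T = {0}`. -/
noncomputable def greatestLowerBound (T : Submodule ℂ (H × H)) : ℝ :=
  sInf (formValues T)

/-- The smallest upper bound `M_T`; it is `0` by convention if `dom T = {0}`. -/
noncomputable def smallestUpperBound (T : Submodule ℂ (H × H)) : ℝ :=
  sSup (formValues T)

end LinearRelation

/-!
The operator part `B = A ∩ ((mul A)ᗮ ⊕ (mul A)ᗮ)` of a selfadjoint relation `A` is a densely
defined selfadjoint operator in `(mul A)ᗮ`, because `(dom A)ᗮ = mul A`, and `A` is the orthogonal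
sum of `B` and `{0} × mul A`. In particular `A` and `B` have the same quadratic form.

* If the form lies in `[-c, c]`, polarization and the density of `dom B` give `‖g‖ ≤ c ‖f‖` on `B`
  (`norm_le_of_abs_re_inner_le`). Hence `B` is bounded; being closed and densely defined, it is
  everywhere defined. The same estimate with `c = max |m_A| |M_A|` is the norm formula.
* If `|⟪f, g - ζ f⟫| ≥ d ‖f‖ ^ 2` on `A` for some `d > 0`, then `A - ζ` is bounded below, so its
  range is closed; its orthogonal complement is the kernel of `A - conj ζ`, which is trivial
  (`IsSelfadjoint.mem_regularSet`). This applies to each `ζ` outside `[m_A, M_A]`, and so locates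
  the spectrum.
* If every real `x ≤ m` is regular, then `R = (A - m)⁻¹` is a bounded selfadjoint operator. The
  spectral mapping `x ↦ (x - m)⁻¹` shows that `R` has no negative spectrum, so `R ≥ 0`, which means
  that `A ≥ m` (`IsSelfadjoint.mul_norm_sq_le_re_inner`). Applied to `A` and `-A`, this
  yields semi-boundedness from a bounded spectrum.
-/

namespace LinearRelation

/-! ### Membership in the derived relations -/

section Basic

variable {E : Type*} [NormedAddCommGroup E] [InnerProductSpace ℂ E] {T : Submodule ℂ (E × E)}

theorem mem_dom {f : E} : f ∈ dom T ↔ ∃ g, (f, g) ∈ T := by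
  simp [dom]

theorem mem_mul {g : E} : g ∈ mul T ↔ (0, g) ∈ T := by
  simp [mul]

theorem mem_opposite {f g : E} : (f, g) ∈ opposite T ↔ (f, -g) ∈ T := by
  constructor
  · rintro ⟨⟨a, b⟩, h, heq⟩
    have h1 : a = f := congrArg Prod.fst heq
    have h2 : -b = g := congrArg Prod.snd heq
    rw [← h1, ← h2, neg_neg]
    exact h
  · intro h
    exact ⟨(f, -g), h, Prod.ext rfl (neg_neg g)⟩

theorem mem_inverse_subScalar {ζ : ℂ} {f k : E} :
    (k, f) ∈ inverse (subScalar T ζ) ↔ (f, k + ζ • f) ∈ T := by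
  constructor
  · rintro ⟨_, ⟨⟨a, b⟩, h, rfl⟩, heq⟩
    have h1 : b - ζ • a = k := congrArg Prod.fst heq
    have h2 : a = f := congrArg Prod.snd heq
    rw [← h1, ← h2, sub_add_cancel]
    exact h
  · intro h
    exact ⟨(f, k), ⟨(f, k + ζ • f), h, Prod.ext rfl (add_sub_cancel_right k (ζ • f))⟩, rfl⟩

theorem mem_restrict {S : Submodule ℂ (E × E)} {f g : (mul S)ᗮ} :
    (f, g) ∈ restrict T S ↔ ((f : E), (g : E)) ∈ T :=
  Iff.rfl

theorem mem_regularSet {ζ : ℂ} :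
    ζ ∈ regularSet T ↔ (∃ C : ℝ, 0 < C ∧ ∀ f g, (f, g) ∈ T → ‖f‖ ≤ C * ‖g - ζ • f‖) ∧
      ∀ k, ∃ f, (f, k + ζ • f) ∈ T := by
  simp only [regularSet, Set.mem_ofPred_eq, IsBoundedOperator, IsBounded, mem_inverse_subScalar,
    Submodule.eq_top_iff', mem_dom]
  refine and_congr_left fun _ => exists_congr fun C => and_congr_right fun _ => ?_
  constructor
  · intro h f g hfg
    exact h (g - ζ • f) f (by simpa using hfg)
  · intro h k f hfk
    simpa using h f _ hfk

theorem mem_regularSet_opposite {ζ : ℂ} : ζ ∈ regularSet (opposite T) ↔ -ζ ∈ regularSet T := by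
  simp only [mem_regularSet, mem_opposite]
  refine and_congr (exists_congr fun C => and_congr_right fun _ => ?_) ?_
  · constructor
    · intro h f g hfg
      have := h f (-g) (by simpa using hfg)
      rwa [show -g - ζ • f = -(g - (-ζ) • f) by module, norm_neg] at this
    · intro h f g hfg
      have := h f (-g) hfg
      rwa [show -g - (-ζ) • f = -(g - ζ • f) by module, norm_neg] at this
  · constructor
    · intro h k
      obtain ⟨f, hf⟩ := h (-k)
      exact ⟨f, by rwa [show -(-k + ζ • f) = k + (-ζ) • f by module] at hf⟩
    · intro h k
      obtain ⟨f, hf⟩ := h (-k)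
      exact ⟨f, by rwa [show -k + (-ζ) • f = -(k + ζ • f) by module] at hf⟩

theorem IsBounded.eq_of_mem (hT : IsBounded T) {f g g' : E} (h : (f, g) ∈ T) (h' : (f, g') ∈ T) :
    g = g' := by
  obtain ⟨C, -, hC⟩ := hT
  have := hC 0 (g - g') (by simpa using T.sub_mem h h')
  rw [norm_zero, mul_zero, norm_le_zero_iff] at this
  exact sub_eq_zero.1 this

theorem IsBoundedOperator.exists_continuousLinearMap (hT : IsBoundedOperator T) :
    ∃ R : E →L[ℂ] E, LinearMap.graph (R : E →ₗ[ℂ] E) = T := by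
  have hex : ∀ f, ∃ g, (f, g) ∈ T := fun f => mem_dom.1 (hT.2 ▸ Submodule.mem_top)
  choose R hR using hex
  let L : E →ₗ[ℂ] E :=
    { toFun := R
      map_add' := fun x y => hT.1.eq_of_mem (hR _) (T.add_mem (hR x) (hR y))
      map_smul' := fun a x => hT.1.eq_of_mem (hR _) (T.smul_mem a (hR x)) }
  obtain ⟨C, -, hC⟩ := id hT.1
  refine ⟨L.mkContinuous C fun x => hC _ _ (hR x), ?_⟩
  ext ⟨f, g⟩
  simp only [LinearMap.mem_graph_iff]
  constructor
  · rintro rfl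
    exact hR f
  · intro h
    exact hT.1.eq_of_mem h (hR f)

/-- The image of a closed subspace under a continuous linear map that is bounded below on it is
closed. -/
theorem isClosed_map_of_norm_le {E F : Type*} [NormedAddCommGroup E] [NormedSpace ℂ E]
    [CompleteSpace E] [NormedAddCommGroup F] [NormedSpace ℂ F] {S : Submodule ℂ E}
    (hS : IsClosed (S : Set E)) (L : E →L[ℂ] F) {C : ℝ} (h : ∀ x ∈ S, ‖x‖ ≤ C * ‖L x‖) :
    IsClosed (S.map (L : E →ₗ[ℂ] F) : Set F) := by
  have : CompleteSpace S := hS.completeSpace_coe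
  have hanti : AntilipschitzWith C.toNNReal (L.comp S.subtypeL) := by
    refine ContinuousLinearMap.antilipschitz_of_bound _ fun x => ?_
    refine (h x x.2).trans ?_
    exact mul_le_mul_of_nonneg_right (Real.le_coe_toNNReal C) (norm_nonneg _)
  have := hanti.isClosed_range (L.comp S.subtypeL).uniformContinuous
  convert this using 1
  ext y
  simp

/-- A symmetric, densely defined relation whose quadratic form is bounded by `c` is bounded, with
the same constant. -/
theorem norm_le_of_abs_re_inner_le
    (hsymm : ∀ f g f' g', (f, g) ∈ T → (f', g') ∈ T → inner ℂ g f' = inner ℂ f g')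
    (hdense : Dense (dom T : Set E)) {c : ℝ} (hc : 0 ≤ c)
    (h : ∀ f g, (f, g) ∈ T → |(inner ℂ f g).re| ≤ c * ‖f‖ ^ 2) {f g : E} (hfg : (f, g) ∈ T) :
    ‖g‖ ≤ c * ‖f‖ := by
  have key : ∀ x : E, 2 * (inner ℂ x g).re ≤ c * (‖f‖ ^ 2 + ‖x‖ ^ 2) := by
    intro x
    refine hdense.induction (P := fun x => 2 * (inner ℂ x g).re ≤ c * (‖f‖ ^ 2 + ‖x‖ ^ 2))
      ?_ (isClosed_le (by fun_prop) (by fun_prop)) x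
    intro x hx
    obtain ⟨y, hxy⟩ := mem_dom.1 hx
    have h1 := (abs_le.1 (h _ _ (T.add_mem hfg hxy))).2
    have h2 := (abs_le.1 (h _ _ (T.sub_mem hfg hxy))).1
    have h3 : (inner ℂ f y).re = (inner ℂ x g).re := by
      rw [← hsymm _ _ _ _ hfg hxy, ← inner_conj_symm, Complex.conj_re]
    have h4 := parallelogram_law_with_norm ℂ f x
    simp only [inner_add_left, inner_add_right, inner_sub_left, inner_sub_right, Complex.add_re,
      Complex.sub_re] at h1 h2
    nlinarith
  have hre : ∀ t : ℝ, 2 * (t * ‖g‖ ^ 2) ≤ c * (‖f‖ ^ 2 + t ^ 2 * ‖g‖ ^ 2) := by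
    intro t
    have := key ((t : ℂ) • g)
    rw [inner_smul_left, Complex.conj_ofReal, inner_self_eq_norm_sq_to_K, norm_smul, mul_pow,
      Complex.norm_real, Real.norm_eq_abs, sq_abs] at this
    simpa [← Complex.ofReal_pow] using this
  rcases hc.eq_or_lt with rfl | hc
  · have := hre 1
    have : ‖g‖ ^ 2 ≤ 0 := by linarith
    have : ‖g‖ = 0 := by nlinarith [norm_nonneg g]
    simp [this]
  · -- `t = c⁻¹` is the optimal multiple of `g`.
    have h1 := mul_le_mul_of_nonneg_left (hre c⁻¹) hc.le
    have h2 : ‖g‖ ^ 2 ≤ (c * ‖f‖) ^ 2 := by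
      field_simp at h1
      nlinarith
    exact le_of_sq_le_sq h2 (by positivity)

theorem mul_restrict_self : mul (restrict T T) = ⊥ := by
  rw [eq_bot_iff]
  intro g hg
  have hg' : (g : E) ∈ mul T := mem_mul.2 (mem_restrict.1 (mem_mul.1 hg))
  exact Subtype.ext (inner_self_eq_zero.1 (Submodule.inner_right_of_mem_orthogonal hg' g.2))

end Basic

/-! ### Selfadjoint relations -/

section Selfadjoint

variable {E : Type*} [NormedAddCommGroup E] [InnerProductSpace ℂ E] {A : Submodule ℂ (E × E)}

theorem isSelfadjoint_iff :
    IsSelfadjoint A ↔ ∀ h k, (h, k) ∈ A ↔ ∀ f g, (f, g) ∈ A → inner ℂ g h = inner ℂ f k := by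
  simp only [IsSelfadjoint, Submodule.ext_iff, Submodule.mem_adjoint_iff, Prod.forall, sub_eq_zero]

theorem IsSelfadjoint.symm (hA : IsSelfadjoint A) {f g f' g' : E} (h : (f, g) ∈ A)
    (h' : (f', g') ∈ A) : inner ℂ g f' = inner ℂ f g' :=
  (isSelfadjoint_iff.1 hA _ _).1 h' _ _ h

theorem IsSelfadjoint.im_inner (hA : IsSelfadjoint A) {f g : E} (h : (f, g) ∈ A) :
    (inner ℂ f g).im = 0 := by
  rw [← Complex.conj_eq_iff_im, inner_conj_symm, hA.symm h h]

theorem IsSelfadjoint.opposite (hA : IsSelfadjoint A) : IsSelfadjoint (opposite A) := by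
  rw [isSelfadjoint_iff] at hA ⊢
  intro h k
  rw [mem_opposite, hA]
  constructor
  · intro H f g hfg
    simpa using congrArg Neg.neg (H f (-g) (mem_opposite.1 hfg))
  · intro H f g hfg
    simpa using congrArg Neg.neg (H f (-g) (mem_opposite.2 (by simpa using hfg)))

theorem IsSelfadjoint.isClosed (hA : IsSelfadjoint A) : IsClosed (A : Set (E × E)) := by
  have : (A : Set (E × E)) =
      ⋂ p : A, {x | inner ℂ (p : E × E).2 x.1 = inner ℂ (p : E × E).1 x.2} := by
    ext ⟨h, k⟩
    rw [SetLike.mem_coe, isSelfadjoint_iff.1 hA]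
    simp
  rw [this]
  exact isClosed_iInter fun p => isClosed_eq (by fun_prop) (by fun_prop)

theorem IsSelfadjoint.orthogonal_dom (hA : IsSelfadjoint A) : (dom A)ᗮ = mul A := by
  ext k
  rw [mem_mul, isSelfadjoint_iff.1 hA, Submodule.mem_orthogonal]
  simp only [inner_zero_right, mem_dom, forall_exists_index]
  exact forall₃_congr fun f g _ => eq_comm

theorem IsSelfadjoint.dom_le (hA : IsSelfadjoint A) : dom A ≤ (mul A)ᗮ := by
  rw [← hA.orthogonal_dom]
  exact Submodule.le_orthogonal_orthogonal _

theorem IsSelfadjoint.isBoundedOperator [CompleteSpace E] (hA : IsSelfadjoint A)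
    (hb : IsBounded A) : IsBoundedOperator A := by
  refine ⟨hb, ?_⟩
  have hmul : mul A = ⊥ := by
    rw [eq_bot_iff]
    exact fun g hg => (Submodule.mem_bot ℂ).2 (hb.eq_of_mem (mem_mul.1 hg) A.zero_mem)
  obtain ⟨C, hC, hb⟩ := hb
  have hcl : IsClosed (dom A : Set E) := by
    refine isClosed_map_of_norm_le hA.isClosed (ContinuousLinearMap.fst ℂ E E) (C := max 1 C) ?_
    rintro ⟨f, g⟩ hfg
    refine max_le ?_ ((hb f g hfg).trans ?_)
    · exact le_mul_of_one_le_left (norm_nonneg _) (le_max_left _ _)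
    · exact mul_le_mul_of_nonneg_right (le_max_right _ _) (norm_nonneg _)
  have : CompleteSpace (dom A) := hcl.completeSpace_coe
  rw [← Submodule.orthogonal_eq_bot_iff, hA.orthogonal_dom, hmul]

/-- A selfadjoint relation `A` has `ζ` as a regular point as soon as the form of `A - ζ` is bounded
away from zero. -/
theorem IsSelfadjoint.mem_regularSet [CompleteSpace E] (hA : IsSelfadjoint A) {ζ : ℂ} {d : ℝ}
    (hd : 0 < d) (h : ∀ f g, (f, g) ∈ A → d * ‖f‖ ^ 2 ≤ ‖inner ℂ f (g - ζ • f)‖) :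
    ζ ∈ regularSet A := by
  have hbound : ∀ f g, (f, g) ∈ A → ‖f‖ ≤ d⁻¹ * ‖g - ζ • f‖ := by
    intro f g hfg
    rw [← div_eq_inv_mul, le_div_iff₀ hd]
    rcases (norm_nonneg f).eq_or_lt with h0 | h0
    · simp [← h0]
    · have := (h f g hfg).trans (norm_inner_le_norm _ _)
      nlinarith
  let L : E × E →L[ℂ] E := ContinuousLinearMap.snd ℂ E E - ζ • ContinuousLinearMap.fst ℂ E E
  have hcl : IsClosed (A.map (L : E × E →ₗ[ℂ] E) : Set E) := by
    refine isClosed_map_of_norm_le hA.isClosed L (C := 1 + (1 + ‖ζ‖) * d⁻¹) ?_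
    rintro ⟨f, g⟩ hfg
    have hf := hbound f g hfg
    have hg : ‖g‖ ≤ ‖g - ζ • f‖ + ‖ζ‖ * ‖f‖ := by
      simpa [norm_smul] using norm_add_le (g - ζ • f) (ζ • f)
    have hz := mul_le_mul_of_nonneg_left hf (norm_nonneg ζ)
    have h1 : 0 ≤ d⁻¹ * ‖g - ζ • f‖ := by positivity
    have h2 : 0 ≤ ‖ζ‖ * (d⁻¹ * ‖g - ζ • f‖) := by positivity
    have h3 := norm_nonneg (g - ζ • f)
    change max ‖f‖ ‖g‖ ≤ (1 + (1 + ‖ζ‖) * d⁻¹) * ‖g - ζ • f‖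
    refine max_le ?_ ?_ <;> nlinarith
  have : CompleteSpace (A.map (L : E × E →ₗ[ℂ] E)) := hcl.completeSpace_coe
  have htop : A.map (L : E × E →ₗ[ℂ] E) = ⊤ := by
    rw [← Submodule.orthogonal_eq_bot_iff, eq_bot_iff]
    intro k hk
    rw [Submodule.mem_orthogonal] at hk
    have hmem : (k, (starRingEnd ℂ ζ) • k) ∈ A := by
      rw [isSelfadjoint_iff.1 hA]
      intro f g hfg
      have := hk (g - ζ • f) ⟨(f, g), hfg, rfl⟩
      rwa [inner_sub_left, sub_eq_zero, inner_smul_left, ← inner_smul_right] at this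
    by_contra hk0
    replace hk0 : k ≠ 0 := hk0
    have hpos : 0 < ‖k‖ ^ 2 := by positivity
    -- The form of `A` is real, so an eigenvalue of `A` is real.
    have him := hA.im_inner hmem
    rw [inner_smul_right, inner_self_eq_norm_sq_to_K] at him
    have hreal : starRingEnd ℂ ζ = ζ := by
      rw [Complex.conj_eq_iff_im]
      simpa [← Complex.ofReal_pow, hk0] using him
    have := h _ _ hmem
    rw [hreal, sub_self, inner_zero_right, norm_zero] at this
    nlinarith
  refine LinearRelation.mem_regularSet.2 ⟨⟨d⁻¹, inv_pos.2 hd, hbound⟩, fun k => ?_⟩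
  obtain ⟨⟨f, g⟩, hfg, hk⟩ : k ∈ A.map (L : E × E →ₗ[ℂ] E) := htop ▸ Submodule.mem_top
  have hk' : g - ζ • f = k := hk
  exact ⟨f, by rw [← hk', sub_add_cancel]; exact hfg⟩

/-- If no real `x ≤ m` belongs to the spectrum of a selfadjoint relation `A`, then `A ≥ m`. -/
theorem IsSelfadjoint.mul_norm_sq_le_re_inner [CompleteSpace E] (hA : IsSelfadjoint A) {m : ℝ}
    (hm : ∀ x : ℝ, x ≤ m → (x : ℂ) ∈ regularSet A) {f g : E} (hfg : (f, g) ∈ A) :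
    m * ‖f‖ ^ 2 ≤ (inner ℂ f g).re := by
  obtain ⟨R, hR⟩ := IsBoundedOperator.exists_continuousLinearMap (hm m le_rfl)
  have hR' : ∀ k f, f = R k ↔ (f, k + (m : ℂ) • f) ∈ A := by
    intro k f
    rw [← mem_inverse_subScalar, ← hR]
    exact (LinearMap.mem_graph_iff (R : E →ₗ[ℂ] E) (k, f)).symm
  have hsa : IsSelfAdjoint R := by
    rw [ContinuousLinearMap.isSelfAdjoint_iff_isSymmetric]
    intro x y
    have := hA.symm ((hR' x _).1 rfl) ((hR' y _).1 rfl)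
    rw [inner_add_left, inner_add_right, inner_smul_left, inner_smul_right,
      Complex.conj_ofReal] at this
    exact (add_right_cancel this).symm
  have hpos : 0 ≤ R := by
    rw [StarOrderedRing.nonneg_iff_spectrum_nonneg (R := ℝ) R]
    intro μ hμ
    by_contra! hneg
    have hμ0 : (μ : ℂ) ≠ 0 := by exact_mod_cast hneg.ne
    refine hμ ?_
    -- `μ` is regular for `(A - m)⁻¹` because `m + μ⁻¹` is regular for `A`.
    obtain ⟨⟨C, -, hC⟩, hsurj⟩ := LinearRelation.mem_regularSet.1
      (hm (m + μ⁻¹) (by linarith [inv_lt_zero.2 hneg]))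
    rw [_root_.spectrum.mem_resolventSet_iff, ContinuousLinearMap.isUnit_iff_bijective]
    have happ : ∀ x, (algebraMap ℝ (E →L[ℂ] E) μ - R) x = (μ : ℂ) • x - R x := by
      intro x
      simp [Algebra.algebraMap_eq_smul_one]
    constructor
    · rw [injective_iff_map_eq_zero]
      intro x hx
      rw [happ, sub_eq_zero] at hx
      have h1 := hC _ _ ((hR' x _).1 rfl)
      rw [← hx, show x + (m : ℂ) • (μ : ℂ) • x - ((m + μ⁻¹ : ℝ) : ℂ) • (μ : ℂ) • x = 0 by
        push_cast
        match_scalars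
        field_simp
        ring, norm_zero, mul_zero, norm_le_zero_iff] at h1
      exact (smul_eq_zero.1 h1).resolve_left hμ0
    · intro k
      obtain ⟨f, hf⟩ := hsurj ((μ : ℂ)⁻¹ • k)
      refine ⟨(μ : ℂ)⁻¹ • (k + f), ?_⟩
      have : f = R ((μ : ℂ)⁻¹ • (k + f)) := by
        rw [hR']
        convert hf using 2
        push_cast
        module
      rw [happ, ← this, smul_inv_smul₀ hμ0, add_sub_cancel_right]
  have hf : f = R (g - (m : ℂ) • f) := by
    rw [hR']
    simpa using hfg
  have := ((ContinuousLinearMap.nonneg_iff_isPositive R).1 hpos).re_inner_nonneg_left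
    (g - (m : ℂ) • f)
  rw [← hf, inner_sub_right, inner_smul_right, inner_self_eq_norm_sq_to_K] at this
  simpa [← Complex.ofReal_pow] using this

theorem IsSelfadjoint.isUpperSemibounded_iff (hA : IsSelfadjoint A) :
    IsUpperSemibounded A ↔ ∃ M : ℝ, ∀ f g, (f, g) ∈ A → (inner ℂ f g).re ≤ M * ‖f‖ ^ 2 := by
  constructor
  · rintro ⟨m, hm⟩
    refine ⟨-m, fun f g hfg => ?_⟩
    have := (hm f (-g) (mem_opposite.2 (by simpa using hfg))).2
    rw [inner_neg_right, Complex.neg_re] at this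
    linarith
  · rintro ⟨M, hM⟩
    refine ⟨-M, fun f g hfg => ⟨hA.opposite.im_inner hfg, ?_⟩⟩
    have := hM f (-g) (mem_opposite.1 hfg)
    rw [inner_neg_right, Complex.neg_re] at this
    linarith

end Selfadjoint

/-! ### The operator part -/

section OperatorPart

variable {H : Type*} [NormedAddCommGroup H] [InnerProductSpace ℂ H] [CompleteSpace H]
  {A : Submodule ℂ (H × H)}

/-- A selfadjoint relation is the orthogonal sum of its operator part and `{0} × mul A`. -/
theorem IsSelfadjoint.exists_mem_restrict (hA : IsSelfadjoint A) {f g : H} (hfg : (f, g) ∈ A) :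
    ∃ f' g' : (mul A)ᗮ, (f', g') ∈ restrict A A ∧ (f' : H) = f ∧
      ∀ x : (mul A)ᗮ, inner ℂ (x : H) g = inner ℂ x g' := by
  obtain ⟨y, hy, z, hz, rfl⟩ := (mul A)ᗮ.exists_add_mem_mem_orthogonal g
  have hzmul : z ∈ mul A := by
    rw [← hA.orthogonal_dom]
    exact Submodule.orthogonal_le hA.dom_le hz
  refine ⟨⟨f, hA.dom_le (mem_dom.2 ⟨_, hfg⟩)⟩, ⟨y, hy⟩, ?_, rfl, fun x => ?_⟩
  · rw [mem_restrict]
    simpa using A.sub_mem hfg (mem_mul.1 hzmul)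
  · rw [inner_add_right, Submodule.inner_right_of_mem_orthogonal x.2 hz, add_zero,
      Submodule.coe_inner]

theorem IsSelfadjoint.restrict (hA : IsSelfadjoint A) : IsSelfadjoint (restrict A A) := by
  rw [isSelfadjoint_iff]
  intro h k
  constructor
  · intro hhk f g hfg
    exact hA.symm hfg hhk
  · intro H
    rw [mem_restrict, isSelfadjoint_iff.1 hA]
    intro f g hfg
    obtain ⟨f', g', h', rfl, hg⟩ := hA.exists_mem_restrict hfg
    rw [← inner_conj_symm, hg, inner_conj_symm]
    exact H f' g' h'

theorem IsSelfadjoint.dense_dom_restrict (hA : IsSelfadjoint A) :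
    Dense (dom (LinearRelation.restrict A A) : Set (mul A)ᗮ) := by
  rw [Submodule.dense_iff_topologicalClosure_eq_top, Submodule.topologicalClosure_eq_top_iff,
    hA.restrict.orthogonal_dom, mul_restrict_self]

theorem IsSelfadjoint.norm_le_of_mem_restrict (hA : IsSelfadjoint A) {c : ℝ} (hc : 0 ≤ c)
    (h : ∀ f g, (f, g) ∈ A → |(inner ℂ f g).re| ≤ c * ‖f‖ ^ 2) {f g : (mul A)ᗮ}
    (hfg : (f, g) ∈ LinearRelation.restrict A A) : ‖g‖ ≤ c * ‖f‖ :=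
  norm_le_of_abs_re_inner_le (fun _ _ _ _ h h' => hA.restrict.symm h h') hA.dense_dom_restrict hc
    (fun _ _ hfg => h _ _ hfg) hfg

theorem IsSelfadjoint.norm_inner_le_of_restrict (hA : IsSelfadjoint A) {c : ℝ}
    (h : ∀ f g, (f, g) ∈ LinearRelation.restrict A A → ‖g‖ ≤ c * ‖f‖) {f g : H}
    (hfg : (f, g) ∈ A) : ‖inner ℂ f g‖ ≤ c * ‖f‖ ^ 2 := by
  obtain ⟨f', g', h', rfl, hg⟩ := hA.exists_mem_restrict hfg
  rw [hg]
  refine (norm_inner_le_norm _ _).trans ?_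
  have := mul_le_mul_of_nonneg_left (h _ _ h') (norm_nonneg f')
  rw [Submodule.coe_norm] at *
  nlinarith

end OperatorPart

/-! ### The bounds of a selfadjoint relation -/

section Bounds

variable {E : Type*} [NormedAddCommGroup E] [InnerProductSpace ℂ E] {A : Submodule ℂ (E × E)}

theorem IsSelfadjoint.div_mem_formValues (hA : IsSelfadjoint A) {f g : E} (hfg : (f, g) ∈ A)
    (hf : f ≠ 0) : (inner ℂ f g).re / ‖f‖ ^ 2 ∈ formValues A := by
  have hn : ‖f‖ ≠ 0 := norm_ne_zero_iff.2 hf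
  refine ⟨((‖f‖⁻¹ : ℝ) : ℂ) • f, ((‖f‖⁻¹ : ℝ) : ℂ) • g, A.smul_mem _ hfg, ?_, ?_⟩
  · rw [norm_smul, Complex.norm_real, norm_inv, norm_norm, inv_mul_cancel₀ hn]
  · rw [inner_smul_left, inner_smul_right, Complex.conj_ofReal,
      ← Complex.re_add_im (inner ℂ f g), hA.im_inner hfg]
    push_cast
    field_simp
    simp

theorem formValues_eq_empty (h : dom A = ⊥) : formValues A = ∅ := by
  rw [Set.eq_empty_iff_forall_notMem]
  rintro r ⟨f, g, hfg, hf, -⟩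
  have : f ∈ dom A := mem_dom.2 ⟨g, hfg⟩
  rw [h, Submodule.mem_bot] at this
  simp [this] at hf

theorem IsSelfadjoint.formValues_nonempty (hA : IsSelfadjoint A) (h : dom A ≠ ⊥) :
    (formValues A).Nonempty := by
  obtain ⟨f, hf, hf0⟩ := (Submodule.ne_bot_iff _).1 h
  obtain ⟨g, hfg⟩ := mem_dom.1 hf
  exact ⟨_, hA.div_mem_formValues hfg hf0⟩

theorem IsLowerSemibounded.bddBelow (h : IsLowerSemibounded A) : BddBelow (formValues A) := by
  obtain ⟨m, hm⟩ := h
  refine ⟨m, ?_⟩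
  rintro r ⟨f, g, hfg, hf, hr⟩
  simpa [hf, hr] using (hm f g hfg).2

theorem IsSelfadjoint.bddAbove (hA : IsSelfadjoint A) (h : IsUpperSemibounded A) :
    BddAbove (formValues A) := by
  obtain ⟨M, hM⟩ := hA.isUpperSemibounded_iff.1 h
  refine ⟨M, ?_⟩
  rintro r ⟨f, g, hfg, hf, hr⟩
  simpa [hf, hr] using hM f g hfg

theorem IsSelfadjoint.greatestLowerBound_mul_le (hA : IsSelfadjoint A)
    (h : IsLowerSemibounded A) {f g : E} (hfg : (f, g) ∈ A) :
    greatestLowerBound A * ‖f‖ ^ 2 ≤ (inner ℂ f g).re := by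
  by_cases hf : f = 0
  · simp [hf]
  · have hn : 0 < ‖f‖ ^ 2 := by positivity
    exact (le_div_iff₀ hn).1 (csInf_le h.bddBelow (hA.div_mem_formValues hfg hf))

theorem IsSelfadjoint.le_smallestUpperBound_mul (hA : IsSelfadjoint A)
    (h : IsUpperSemibounded A) {f g : E} (hfg : (f, g) ∈ A) :
    (inner ℂ f g).re ≤ smallestUpperBound A * ‖f‖ ^ 2 := by
  by_cases hf : f = 0
  · simp [hf]
  · have hn : 0 < ‖f‖ ^ 2 := by positivity
    exact (div_le_iff₀ hn).1 (le_csSup (hA.bddAbove h) (hA.div_mem_formValues hfg hf))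

theorem IsSelfadjoint.abs_re_inner_le (hA : IsSelfadjoint A) (hl : IsLowerSemibounded A)
    (hu : IsUpperSemibounded A) {f g : E} (hfg : (f, g) ∈ A) :
    |(inner ℂ f g).re| ≤ max |greatestLowerBound A| |smallestUpperBound A| * ‖f‖ ^ 2 := by
  have h1 := hA.greatestLowerBound_mul_le hl hfg
  have h2 := hA.le_smallestUpperBound_mul hu hfg
  have hn := sq_nonneg ‖f‖
  rw [abs_le]
  constructor
  · have := (neg_le_neg (le_max_left |greatestLowerBound A| |smallestUpperBound A|)).trans
      (neg_abs_le _)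
    nlinarith
  · have := (le_abs_self _).trans (le_max_right |greatestLowerBound A| |smallestUpperBound A|)
    nlinarith

theorem IsSelfadjoint.spectrum_subset [CompleteSpace E] (hA : IsSelfadjoint A)
    (hl : IsLowerSemibounded A) (hu : IsUpperSemibounded A) :
    spectrum A ⊆ ((↑) : ℝ → ℂ) '' Set.Icc (greatestLowerBound A) (smallestUpperBound A) := by
  intro ζ hζ
  have hinner : ∀ f g : E, inner ℂ f (g - ζ • f) = inner ℂ f g - ζ * ((‖f‖ ^ 2 : ℝ) : ℂ) := by
    intro f g
    rw [inner_sub_right, inner_smul_right, inner_self_eq_norm_sq_to_K]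
    simp
  by_cases him : ζ.im = 0
  · refine ⟨ζ.re, ⟨?_, ?_⟩, Complex.ext rfl him.symm⟩
    · by_contra! hlt
      refine hζ (hA.mem_regularSet (sub_pos.2 hlt) fun f g hfg => ?_)
      refine le_trans ?_ (Complex.abs_re_le_norm _)
      rw [hinner, Complex.sub_re, Complex.re_mul_ofReal]
      have := hA.greatestLowerBound_mul_le hl hfg
      exact le_trans (by linarith) (le_abs_self _)
    · by_contra! hlt
      refine hζ (hA.mem_regularSet (sub_pos.2 hlt) fun f g hfg => ?_)
      refine le_trans ?_ (Complex.abs_re_le_norm _)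
      rw [hinner, Complex.sub_re, Complex.re_mul_ofReal]
      have := hA.le_smallestUpperBound_mul hu hfg
      exact le_trans (by linarith) (neg_le_abs _)
  · refine absurd (hA.mem_regularSet (abs_pos.2 him) fun f g hfg => ?_) hζ
    refine le_trans ?_ (Complex.abs_im_le_norm _)
    rw [hinner, Complex.sub_im, Complex.im_mul_ofReal, hA.im_inner hfg, zero_sub, abs_neg, abs_mul,
      abs_of_nonneg (sq_nonneg ‖f‖)]

theorem IsSelfadjoint.semibounded_of_isBounded_spectrum [CompleteSpace E] (hA : IsSelfadjoint A)
    (h : Bornology.IsBounded (spectrum A)) : IsLowerSemibounded A ∧ IsUpperSemibounded A := by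
  obtain ⟨c, hc⟩ := h.exists_norm_le
  have hreg : ∀ x : ℝ, x ≤ -(|c| + 1) → (x : ℂ) ∈ regularSet A ∧ -(x : ℂ) ∈ regularSet A := by
    intro x hx
    have hx' : c < |x| := by
      have := neg_le_abs x
      have := le_abs_self c
      linarith
    constructor <;>
    · by_contra hn
      have := hc _ hn
      simp only [norm_neg, Complex.norm_real, Real.norm_eq_abs] at this
      linarith
  refine ⟨⟨-(|c| + 1), fun f g hfg => ⟨hA.im_inner hfg, ?_⟩⟩,
    ⟨-(|c| + 1), fun f g hfg => ⟨hA.opposite.im_inner hfg, ?_⟩⟩⟩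
  · exact hA.mul_norm_sq_le_re_inner (fun x hx => (hreg x hx).1) hfg
  · exact hA.opposite.mul_norm_sq_le_re_inner
      (fun x hx => mem_regularSet_opposite.2 (hreg x hx).2) hfg

end Bounds

/-! ### Bounded selfadjoint relations -/

section Bounded

variable {H : Type*} [NormedAddCommGroup H] [InnerProductSpace ℂ H] [CompleteSpace H]
  {A : Submodule ℂ (H × H)}

theorem IsSelfadjoint.isBoundedOperator_restrict (hA : IsSelfadjoint A)
    (hl : IsLowerSemibounded A) (hu : IsUpperSemibounded A) :
    IsBoundedOperator (LinearRelation.restrict A A) := by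
  refine hA.restrict.isBoundedOperator
    ⟨max |greatestLowerBound A| |smallestUpperBound A| + 1, by positivity, fun f g hfg => ?_⟩
  refine (hA.norm_le_of_mem_restrict (by positivity)
    (fun f g hfg => hA.abs_re_inner_le hl hu hfg) hfg).trans ?_
  exact mul_le_mul_of_nonneg_right (by linarith) (norm_nonneg _)

theorem IsSelfadjoint.semibounded_of_isBounded_restrict (hA : IsSelfadjoint A)
    (h : IsBounded (LinearRelation.restrict A A)) :
    IsLowerSemibounded A ∧ IsUpperSemibounded A := by
  obtain ⟨C, -, hC⟩ := h
  have key : ∀ f g, (f, g) ∈ A → |(inner ℂ f g).re| ≤ C * ‖f‖ ^ 2 := fun f g hfg =>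
    (Complex.abs_re_le_norm _).trans (hA.norm_inner_le_of_restrict hC hfg)
  refine ⟨⟨-C, fun f g hfg => ⟨hA.im_inner hfg, ?_⟩⟩, hA.isUpperSemibounded_iff.2
    ⟨C, fun f g hfg => (abs_le.1 (key f g hfg)).2⟩⟩
  linarith [(abs_le.1 (key f g hfg)).1]

theorem IsSelfadjoint.norm_eq_of_graph_eq (hA : IsSelfadjoint A) (hl : IsLowerSemibounded A)
    (hu : IsUpperSemibounded A) {T : (mul A)ᗮ →L[ℂ] (mul A)ᗮ}
    (hT : LinearMap.graph (T : (mul A)ᗮ →ₗ[ℂ] (mul A)ᗮ) = LinearRelation.restrict A A) :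
    ‖T‖ = max |greatestLowerBound A| |smallestUpperBound A| := by
  apply le_antisymm
  · refine T.opNorm_le_bound (by positivity) fun f => ?_
    refine hA.norm_le_of_mem_restrict (by positivity)
      (fun f g hfg => hA.abs_re_inner_le hl hu hfg) ?_
    rw [← hT]
    exact (LinearMap.mem_graph_iff _ _).2 rfl
  · by_cases hdom : dom A = ⊥
    · -- Both bounds are `0` by convention.
      simp [greatestLowerBound, smallestUpperBound, formValues_eq_empty hdom, T.opNorm_nonneg]
    have key : ∀ r ∈ formValues A, |r| ≤ ‖T‖ := by
      rintro r ⟨f, g, hfg, hf, hr⟩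
      have := hA.norm_inner_le_of_restrict (c := ‖T‖) (fun f g hfg => by
        rw [← hT] at hfg
        have hg : g = T f := (LinearMap.mem_graph_iff _ _).1 hfg
        rw [hg]
        exact T.le_opNorm f) hfg
      simpa [hr, hf] using this
    obtain ⟨r, hr⟩ := hA.formValues_nonempty hdom
    have h1 : greatestLowerBound A ≤ r := csInf_le hl.bddBelow hr
    have h2 : r ≤ smallestUpperBound A := le_csSup (hA.bddAbove hu) hr
    have h3 : -‖T‖ ≤ greatestLowerBound A := le_csInf ⟨r, hr⟩ fun x hx => (abs_le.1 (key x hx)).1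
    have h4 : smallestUpperBound A ≤ ‖T‖ := csSup_le ⟨r, hr⟩ fun x hx => (abs_le.1 (key x hx)).2
    exact max_le (abs_le.2 ⟨h3, by linarith⟩) (abs_le.2 ⟨by linarith, h4⟩)

end Bounded

end LinearRelation

theorem mainTheorem6 {H : Type*} [NormedAddCommGroup H] [InnerProductSpace ℂ H] [CompleteSpace H]
    (A : Submodule ℂ (H × H)) (hA : LinearRelation.IsSelfadjoint A) :
    List.TFAE [
      LinearRelation.IsLowerSemibounded A ∧ LinearRelation.IsUpperSemibounded A,
      LinearRelation.spectrum A ⊆ Set.range ((↑) : ℝ → ℂ) ∧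
        Bornology.IsBounded (LinearRelation.spectrum A),
      LinearRelation.IsSelfadjoint (LinearRelation.restrict A A) ∧
        LinearRelation.IsBoundedOperator (LinearRelation.restrict A A)] ∧
    (LinearRelation.IsLowerSemibounded A ∧ LinearRelation.IsUpperSemibounded A →
      (LinearRelation.dom A ≠ ⊥ →
        IsGLB (LinearRelation.formValues A) (LinearRelation.greatestLowerBound A) ∧
        IsLUB (LinearRelation.formValues A) (LinearRelation.smallestUpperBound A)) ∧
      LinearRelation.spectrum A ⊆ ((↑) : ℝ → ℂ) ''
        Set.Icc (LinearRelation.greatestLowerBound A) (LinearRelation.smallestUpperBound A) ∧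
      ∃ T : (LinearRelation.mul A)ᗮ →L[ℂ] (LinearRelation.mul A)ᗮ,
        LinearMap.graph (T : (LinearRelation.mul A)ᗮ →ₗ[ℂ] (LinearRelation.mul A)ᗮ) =
          LinearRelation.restrict A A ∧
        ‖T‖ = max |LinearRelation.greatestLowerBound A| |LinearRelation.smallestUpperBound A|) := by
  refine ⟨?_, fun ⟨hl, hu⟩ => ⟨fun hdom => ?_, hA.spectrum_subset hl hu, ?_⟩⟩
  · tfae_have 1 → 3 := fun h => ⟨hA.restrict, hA.isBoundedOperator_restrict h.1 h.2⟩
    tfae_have 3 → 1 := fun h => hA.semibounded_of_isBounded_restrict h.2.1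
    tfae_have 1 → 2 := fun h => by
      have hsub := hA.spectrum_subset h.1 h.2
      refine ⟨hsub.trans (Set.image_subset_range _ _), Bornology.IsBounded.subset ?_ hsub⟩
      exact (isCompact_Icc.image Complex.continuous_ofReal).isBounded
    tfae_have 2 → 1 := fun h => hA.semibounded_of_isBounded_spectrum h.2
    tfae_finish
  · have hne := hA.formValues_nonempty hdom
    exact ⟨isGLB_csInf hne hl.bddBelow, isLUB_csSup hne (hA.bddAbove hu)⟩
  · obtain ⟨T, hT⟩ := (hA.isBoundedOperator_restrict hl hu).exists_continuousLinearMap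
    exact ⟨T, hT, hA.norm_eq_of_graph_eq hl hu hT⟩
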